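/- **Theorem.** An equational theory $T=(L,A)$ consists of a set $L$ of function symbols with finite arities and a set $A$ of equations in context $s=t:\langle x_1,\dots,x_n\rangle$, where $s,t$ are terms over $L$ whose variables are among $x_1,\dots,x_n$. Provability $A\vdash s=t$ is provability in equational logic: $s$ and $t$ are joined by a finite chain of rewrite steps, each replacing a subterm that is a substitution instance of one side of an equation of $A$ by the same instance of the other side. A term in context $t:\langle x_1,\dots,x_n\rangle$ is *linear-regular* if each of $x_1,\dots,x_n$ occurs in $t$ exactly once, and an equation in context is linear-regular if both of its sides are. The theory $T$ is *linear-regular* if all its consequences are consequences of its linear-regular consequences. It is *rigid* if it is linear-regular and, for every $n$, every linear-regular term $t:\langle x_1,\dots,x_n\rangle$ and every permutation $\sigma\in S_n$, $A\vdash t(x_1,\dots,x_n)=t(x_{\sigma(1)},\dots,x_{\sigma(n)})$ implies $\sigma=\mathrm{id}$. The problem whether a given equational theory $T=(L,A)$ in a finite language $L$ with a finite set $A$ of linear-regular axioms is rigid is undecidable. That is, there is no algorithm (partial recursive function) which, given as input the list of arities of the symbols of $L$ and the list of the axioms (for each axiom the length of its context and its two sides, written as words in Polish notation), for every such $T$ halts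 and answers correctly whether $T$ is rigid. -/

import Mathlib

namespace RigidTheory

section General

universe u v

/-- An equation in context `s = t : x₁, …, xₙ` over the function symbols of `L`.  The variables of
the context are indexed by `Fin n`, so only these variables may occur in the two terms. -/
structure Equation (L : FirstOrder.Language.{u, v}) where
  /-- the length of the context -/
  ctx : ℕ
  /-- the left-hand side -/
  lhs : L.Term (Fin ctx)
  /-- the right-hand side -/
  rhs : L.Term (Fin ctx)

variable {L : FirstOrder.Language.{u, v}}

/-- The number of occurrences of the variable `i` in a term. -/
def occ {n : ℕ} (i : Fin n) : L.Term (Fin n) → ℕ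
  | .var j => if j = i then 1 else 0
  | .func _ ts => ∑ j, occ i (ts j)

/-- A term in context is linear-regular if every variable of the context occurs exactly once. -/
def IsLinearRegularTerm {n : ℕ} (t : L.Term (Fin n)) : Prop :=
  ∀ i : Fin n, occ i t = 1

/-- An equation in context is linear-regular if both of its sides are. -/
def Equation.IsLinearRegular (e : Equation L) : Prop :=
  IsLinearRegularTerm e.lhs ∧ IsLinearRegularTerm e.rhs

/-- One rewrite step (from left to right): one subterm, which is a substitution instance of the
left-hand side of an equation of `A`, is replaced by the same instance of the right-hand side. -/
inductive Step (A : Set (Equation L)) {n : ℕ} : L.Term (Fin n) → L.Term (Fin n) → Prop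
  | root (e : Equation L) (he : e ∈ A) (σ : Fin e.ctx → L.Term (Fin n)) :
      Step A (e.lhs.subst σ) (e.rhs.subst σ)
  | arg {k : ℕ} (f : L.Functions k) (ts : Fin k → L.Term (Fin n)) (j : Fin k)
      (s : L.Term (Fin n)) (h : Step A (ts j) s) :
      Step A (.func f ts) (.func f (Function.update ts j s))

/-- `A ⊢ s = t : x₁, …, xₙ`: there is a finite chain of rewrite steps, each used in either
direction, that leads from `s` to `t`. -/
def Provable (A : Set (Equation L)) {n : ℕ} (s t : L.Term (Fin n)) : Prop :=
  Relation.EqvGen (Step A) s t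

/-- The theory with axioms `A` is linear-regular: each of its consequences is a consequence of its
linear-regular consequences. -/
def IsLinearRegularTheory (A : Set (Equation L)) : Prop :=
  ∀ (n : ℕ) (s t : L.Term (Fin n)), Provable A s t →
    Provable {e : Equation L | e.IsLinearRegular ∧ Provable A e.lhs e.rhs} s t

/-- The theory with axioms `A` is rigid: it is linear-regular, and no linear-regular term is
provably equal to itself with its variables permuted by a non-identity permutation. -/
def IsRigid (A : Set (Equation L)) : Prop :=
  IsLinearRegularTheory A ∧
    ∀ (n : ℕ) (t : L.Term (Fin n)), IsLinearRegularTerm t →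
      ∀ σ : Equiv.Perm (Fin n), Provable A t (t.relabel σ) → σ = 1

end General

/-- The finite language with `ar.length` function symbols, the `i`-th of which has arity `ar[i]`
(and with no relation symbols). -/
def finLanguage (ar : List ℕ) : FirstOrder.Language.{0, 0} where
  Functions k := {i : Fin ar.length // ar.get i = k}
  Relations _ := Empty

/-- An equational theory in a finite language with finitely many axioms. -/
structure FinTheory where
  /-- the arities of the function symbols -/
  arities : List ℕ
  /-- the axioms -/
  axs : List (Equation (finLanguage arities))

/-- The set of axioms. -/
def FinTheory.axiomSet (T : FinTheory) : Set (Equation (finLanguage T.arities)) :=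
  {e | e ∈ T.axs}

/-- The word (in Polish notation) that spells a term; the `i`-th variable is the letter `inl i` and
the `i`-th function symbol is the letter `inr i`. -/
def codeTerm {ar : List ℕ} {n : ℕ} (t : (finLanguage ar).Term (Fin n)) : List (ℕ ⊕ ℕ) :=
  t.listEncode.map (Sum.map (fun i => i.val) (fun f => f.2.val.val))

/-- The finite data given to an algorithm: the list of arities, and for each axiom the length of its
context and the words that spell its two sides. -/
abbrev Code : Type := List ℕ × List (ℕ × List (ℕ ⊕ ℕ) × List (ℕ ⊕ ℕ))

/-- The code of a finitely axiomatized theory in a finite language. -/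
def FinTheory.code (T : FinTheory) : Code :=
  (T.arities, T.axs.map fun e => (e.ctx, codeTerm e.lhs, codeTerm e.rhs))

end RigidTheory

/-!
The halting problem is reduced to non-rigidity.

Fix a Turing machine `M` with finitely many states and symbols whose halting problem is undecidable
(`exists_machine`). A half-tape is a string of unary symbols applied to a constant, and a
configuration `q(l, r)` is a binary symbol applied to two half-tapes. Each step of `M` becomes a
linear-regular equation, further equations allow a halted configuration to erase its tape, and the
input `w` enters only through the axiom
  `test(start(w), x, y) = test(halted(end, end), y, x)`.
All axioms are linear-regular, so the theory is, and the question is about permutations only.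

If `M` halts on `w`, the equations derive `start(w) = halted(end, end)`, hence
`test(start(w), x, y) = test(start(w), y, x)`, and the theory is not rigid
(`not_isRigid_of_halts`).

If `M` does not halt on `w`, there is a model in which a term remembers the order of its variables,
read from left to right except that `test(c, x, y)` lists the variables of `y` before those of `x`
whenever `c` is a configuration from which `M` halts. "Halts" is invariant under the steps of `M`, so
all axioms hold (`machineAxioms_value_eq`); for the axiom above this uses that `start(w)` does not
halt while `halted(end, end)` does. A provable equation `t(x) = t(σ x)` therefore gives two equal
lists of variables, and `σ` is the identity (`isRigid_of_not_halts`).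

The code of the theory is computable from the input since only one axiom varies, and it spells the
input letter by letter (`computable_code`).
-/

namespace RigidTheory

/-! ### A finite Turing machine with undecidable halting problem -/

section Machine

open Turing PartrecToTM2

/-- The binary digits of a positive number: the lowest one first, then those of its half. -/
theorem trNat_of_pos {n : ℕ} (hn : n ≠ 0) :
    trNat n = (if n % 2 = 0 then Γ'.bit0 else Γ'.bit1) :: trNat (n / 2) := by
  have key0 : ∀ m : Num, m ≠ 0 → trNum (Num.bit0 m) = Γ'.bit0 :: trNum m := by
    rintro (_ | m) h
    · exact absurd rfl h
    · rfl
  have key1 : ∀ m : Num, trNum (Num.bit1 m) = Γ'.bit1 :: trNum m := by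
    rintro (_ | m) <;> rfl
  rcases Nat.even_or_odd' n with ⟨k, rfl | rfl⟩
  · have hk : (k : Num) ≠ 0 := by
      rw [Nat.cast_ne_zero]; omega
    simp only [Nat.mul_mod_right, if_true, Nat.mul_div_cancel_left k two_pos]
    rw [trNat, trNat, ← key0 _ hk, ← Num.bit0_of_bit0, two_mul, Nat.cast_add]
  · have h1 : (2 * k + 1) % 2 = 1 := by omega
    have h2 : (2 * k + 1) / 2 = k := by omega
    simp only [h1, h2, one_ne_zero, if_false]
    rw [trNat, trNat, ← key1, ← Num.bit1_of_bit1, two_mul, Nat.cast_add, Nat.cast_add, Nat.cast_one]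

theorem computable_map_trNat (F : Γ' → ℕ) : Computable fun n => (trNat n).map F := by
  have hg : Primrec₂ fun (_ : Unit) (l : List (List ℕ)) =>
      bif l.length == 0 then some [] else
        (l[l.length / 2]?).map fun r =>
          (bif l.length % 2 == 0 then F Γ'.bit0 else F Γ'.bit1) :: r := by
    have hl : Primrec fun p : Unit × List (List ℕ) => p.2.length :=
      Primrec.list_length.comp Primrec.snd
    refine Primrec.cond (Primrec.beq.comp hl (Primrec.const 0)) (Primrec.const _) ?_
    refine Primrec.option_map
      (Primrec.list_getElem?.comp Primrec.snd (Primrec.nat_div.comp hl (Primrec.const 2))) ?_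
    refine Primrec.list_cons.comp (Primrec.cond ?_ (Primrec.const _) (Primrec.const _)) Primrec.snd
    exact Primrec.beq.comp
      (Primrec.nat_mod.comp (hl.comp Primrec.fst) (Primrec.const 2)) (Primrec.const 0)
  have := Primrec.nat_strong_rec (fun (_ : Unit) n => (trNat n).map F) hg (by
    intro _ n
    rcases eq_or_ne n 0 with rfl | hn
    · simp
    · have h2 : n / 2 < n := by omega
      rw [trNat_of_pos hn]
      rcases Nat.mod_two_eq_zero_or_one n with h | h <;>
        simp [beq_false_of_ne hn, h2, h])
  exact (this.comp (Primrec.const ()) Primrec.id).to_comp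

instance : Finite K' :=
  Finite.of_injective (fun k : K' => (K'.rec 0 1 2 3 k : Fin 4)) (by
    rintro (_ | _ | _ | _) (_ | _ | _ | _) h <;> first | rfl | (exact absurd h (by decide)))

/-- A universal partial recursive function turns the undecidability of halting, which varies the
program, into that for one fixed program, where the argument varies. -/
theorem exists_code_halting :
    ∃ c : ToPartrec.Code, ¬ ComputablePred fun n : ℕ => (c.eval [n]).Dom := by
  have hU : Partrec fun n : ℕ => Nat.Partrec.Code.eval (Denumerable.ofNat Nat.Partrec.Code n) 0 :=
    Nat.Partrec.Code.eval_part.comp (Computable.ofNat _) (Computable.const 0)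
  obtain ⟨c, hc⟩ := ToPartrec.Code.exists_code (Nat.Partrec'.part_iff₁.2 hU)
  refine ⟨c, fun h => ComputablePred.halting_problem 0 ?_⟩
  have h2 := ComputablePred.computable_iff.1 h
  obtain ⟨f, hf, hf'⟩ := h2
  refine ComputablePred.computable_iff.2 ⟨fun c => f (Encodable.encode c),
    hf.comp Computable.encode, ?_⟩
  funext d
  rw [← congrFun hf' (Encodable.encode d)]
  have := hc (Encodable.encode d ::ᵥ List.Vector.nil)
  simp only [List.Vector.head_cons, Denumerable.ofNat_encode] at this
  change (Nat.Partrec.Code.eval d 0).Dom = (c.eval [Encodable.encode d]).Dom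
  rw [show [Encodable.encode d] = (Encodable.encode d ::ᵥ List.Vector.nil).1 from rfl, this]
  rfl

/-- A machine that is supported on a finite set of states can be replaced by one whose type of
states is that set. -/
theorem exists_finite_machine {Γ Λ : Type} [Inhabited Γ] [Inhabited Λ] (M : TM0.Machine Γ Λ)
    (S : Finset Λ) (hS : TM0.Supports M (S : Set Λ)) :
    ∃ (Λ₀ : Type) (_ : Inhabited Λ₀) (_ : Fintype Λ₀) (M₀ : TM0.Machine Γ Λ₀),
      ∀ l, (TM0.eval M₀ l).Dom ↔ (TM0.eval M l).Dom := by
  classical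
  let : Inhabited S := ⟨⟨default, hS.1⟩⟩
  let g₁ : PointedMap Λ S :=
    ⟨fun q => if h : q ∈ S then ⟨q, h⟩ else default, dif_pos hS.1⟩
  let ι : PointedMap Γ Γ := ⟨id, rfl⟩
  have hg : ∀ q ∈ (S : Set Λ), ((g₁ q : S) : Λ) = q := fun q hq =>
    congrArg Subtype.val (dif_pos hq)
  refine ⟨S, inferInstance, inferInstance, M.map ι ι g₁ Subtype.val, fun l => ?_⟩
  have hr := TM0.Machine.map_respects M ι ι g₁ Subtype.val hS (fun _ => rfl) hg
  have h₀ := StateTransition.tr_eval_dom hr (a₁ := TM0.init l) ⟨hS.1, rfl⟩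
  rwa [TM0.map_init, show ⇑ι = id from rfl, List.map_id] at h₀

/-- The chain of emulations of a partial recursive code by a stack machine and then by Turing
machines preserves halting. The stack machine starts in its default state, which therefore has to be
the one that belongs to the code `c`. -/
theorem tm0_eval_dom_iff [Inhabited Λ'] (c : ToPartrec.Code)
    (hd : (default : Λ') = trNormal c Cont'.halt) (v : List ℕ) :
    (TM0.eval (TM1to0.tr (TM2to1.tr PartrecToTM2.tr))
      (TM2to1.trInit K'.main (trList v))).Dom ↔ (c.eval v).Dom := by
  rw [TM1to0.tr_eval]
  refine (TM2to1.tr_eval_dom PartrecToTM2.tr K'.main (trList v)).trans ?_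
  have h₂ := congrArg Part.Dom (PartrecToTM2.tr_eval c v)
  have h₃ : TM2.init (Λ := Λ') (σ := Option Γ') K'.main (trList v) = PartrecToTM2.init c v := by
    simp only [TM2.init, PartrecToTM2.init, hd]
    congr 1
    funext k
    cases k <;> rfl
  change (StateTransition.eval (TM2.step PartrecToTM2.tr) (TM2.init K'.main (trList v))).Dom ↔ _
  rw [h₃]
  exact iff_of_eq h₂

/-- The tape symbol of the emulated stack machine that shows `a` on the stack `k` and nothing on
the other stacks, with bottom marker `b`. -/
def stackSymbol {K : Type*} [DecidableEq K] {Γ : K → Type*} (k : K) (b : Bool) (a : Γ k) :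
    TM2to1.Γ' K Γ :=
  (b, Function.update (fun _ => none) k (some a))

/-- The tape of the emulating machine lists the stack from its bottom, and only the bottom symbol
is marked. -/
theorem trInit_append_singleton {K : Type*} [DecidableEq K] {Γ : K → Type*} (k : K)
    (l : List (Γ k)) (a : Γ k) :
    TM2to1.trInit k (l ++ [a]) = stackSymbol k true a :: (l.map (stackSymbol k false)).reverse := by
  have h : TM2to1.trInit k (l ++ [a]) =
      (true, ((l ++ [a]).reverse.map (stackSymbol k false)).headI.2) ::
        ((l ++ [a]).reverse.map (stackSymbol k false)).tail := rfl
  rw [h, List.reverse_append, List.reverse_singleton, List.singleton_append, List.map_cons,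
    ← List.map_reverse]
  rfl

theorem computable_map_trInit (F : TM2to1.Γ' K' (fun _ => Γ') → ℕ) :
    Computable fun n => (TM2to1.trInit K'.main (trList [n])).map F := by
  have h := computable_map_trNat fun a => F (stackSymbol K'.main false a)
  refine (Computable.list_cons.comp (Computable.const (F (stackSymbol K'.main true Γ'.cons)))
    (Computable.list_reverse.comp h)).of_eq fun n => ?_
  rw [trList, trList, trInit_append_singleton, List.map_cons, List.map_reverse, List.map_map]
  rfl

theorem exists_machine :
    ∃ (Γ Λ : Type) (_ : Inhabited Γ) (_ : Fintype Γ) (_ : Inhabited Λ) (_ : Fintype Λ)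
      (M : TM0.Machine Γ Λ) (input : ℕ → List Γ),
      (∀ F : Γ → ℕ, Computable fun n => (input n).map F) ∧
      ¬ ComputablePred fun n => (TM0.eval M (input n)).Dom := by
  obtain ⟨c, hc⟩ := exists_code_halting
  let : Fintype K' := Fintype.ofFinite _
  -- The default label is the initial state, so it overrides the library's instance.
  let : Inhabited Λ' := ⟨trNormal c Cont'.halt⟩
  have s₂ := TM2to1.tr_supports _ (PartrecToTM2.tr_supports c Cont'.halt)
  obtain ⟨Λ₀, _, _, M₀, h₀⟩ := exists_finite_machine _ _ (TM1to0.tr_supports _ s₂)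
  refine ⟨_, Λ₀, inferInstance, inferInstance, inferInstance, inferInstance, M₀,
    fun n => TM2to1.trInit K'.main (trList [n]), computable_map_trInit, ?_⟩
  simpa only [h₀, tm0_eval_dom_iff c rfl] using hc

end Machine

/-! ### Provability in equational logic -/

section Provability

open FirstOrder Language

variable {L : Language} {A : Set (Equation L)} {n : ℕ}

theorem Provable.trans {s t u : L.Term (Fin n)} (h₁ : Provable A s t) (h₂ : Provable A t u) :
    Provable A s u :=
  Relation.EqvGen.trans _ _ _ h₁ h₂

theorem Provable.symm {s t : L.Term (Fin n)} (h : Provable A s t) : Provable A t s :=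
  Relation.EqvGen.symm _ _ h

theorem Provable.of_mem {e : Equation L} (he : e ∈ A) (σ : Fin e.ctx → L.Term (Fin n)) :
    Provable A (e.lhs.subst σ) (e.rhs.subst σ) :=
  Relation.EqvGen.rel _ _ (Step.root e he σ)

theorem subst_var {α : Type*} (t : L.Term α) : t.subst Term.var = t := by
  induction t with
  | var => rfl
  | func f ts ih => exact congrArg _ (funext ih)

theorem relabel_eq_subst {α β : Type*} (t : L.Term α) (g : α → β) :
    t.relabel g = t.subst fun i => Term.var (g i) := by
  induction t with
  | var => rfl
  | func f ts ih => exact congrArg _ (funext ih)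

theorem Provable.update {k : ℕ} (f : L.Functions k) (ts : Fin k → L.Term (Fin n)) (j : Fin k)
    {s t : L.Term (Fin n)} (h : Provable A s t) :
    Provable A (.func f (Function.update ts j s)) (.func f (Function.update ts j t)) := by
  induction h with
  | rel s t h =>
    have := Step.arg (A := A) f (Function.update ts j s) j t (by simpa using h)
    rw [Function.update_idem] at this
    exact Relation.EqvGen.rel _ _ this
  | refl s => exact Relation.EqvGen.refl _
  | symm s t _ ih => exact ih.symm
  | trans s t u _ _ ih₁ ih₂ => exact ih₁.trans ih₂

/-- Soundness of equational logic. -/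
theorem Provable.realize_eq {N : Type*} [L.Structure N]
    (hN : ∀ e ∈ A, ∀ v : Fin e.ctx → N, e.lhs.realize v = e.rhs.realize v)
    {s t : L.Term (Fin n)} (h : Provable A s t) (v : Fin n → N) : s.realize v = t.realize v := by
  induction h with
  | rel s t h =>
    induction h with
    | root e he σ => simpa only [Term.realize_subst] using hN e he _
    | arg f ts j s _ ih =>
      rw [Term.realize_func, Term.realize_func]
      congr 1
      funext i
      rcases eq_or_ne i j with rfl | hi
      · rw [ih, Function.update_self]
      · rw [Function.update_of_ne hi]
  | refl s => rfl
  | symm s t _ ih => exact ih.symm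
  | trans s t u _ _ ih₁ ih₂ => exact ih₁.trans ih₂

theorem isLinearRegularTheory_of_forall (hA : ∀ e ∈ A, e.IsLinearRegular) :
    IsLinearRegularTheory A := by
  intro n s t h
  have hstep : ∀ s t : L.Term (Fin n), Step A s t →
      Step {e | e.IsLinearRegular ∧ Provable A e.lhs e.rhs} s t := by
    intro s t h
    induction h with
    | root e he σ =>
      exact Step.root (A := {e | e.IsLinearRegular ∧ Provable A e.lhs e.rhs}) e
        ⟨hA e he, by simpa only [subst_var] using Provable.of_mem he Term.var⟩ σ
    | arg f ts j s _ ih => exact Step.arg f ts j s ih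
  exact Relation.EqvGen.mono hstep _ _ h

end Provability

/-! ### The theory attached to a machine and an input -/

section Theory

open FirstOrder Language Turing

/-- The function symbols of the theory that simulates a machine with tape alphabet `Γ` and set of
states `Λ`. -/
inductive Sym (Γ Λ : Type)
  /-- A tape symbol, put in front of a half-tape. -/
  | letter (a : Γ)
  /-- The blank half-tape. -/
  | tapeEnd
  /-- A configuration in the state `q`, with arguments the left half of the tape (nearest cell
  first) and the right half, which starts with the scanned cell. -/
  | state (q : Λ)
  /-- A configuration in which the machine has halted, with the same arguments. -/
  | halted
  /-- The ternary symbol whose last two arguments are to be swapped if its first argument is a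
  configuration from which the machine halts. -/
  | test
  deriving Fintype

/-- The number of arguments of a symbol. -/
def Sym.arity {Γ Λ : Type} : Sym Γ Λ → ℕ
  | letter _ => 1
  | tapeEnd => 0
  | state _ => 2
  | halted => 2
  | test => 3

variable {Γ Λ : Type} [Fintype Γ] [Fintype Λ]

variable (Γ Λ) in
/-- The arities of all symbols, in some fixed enumeration. -/
noncomputable def arities : List ℕ :=
  List.ofFn fun i => ((Fintype.equivFin (Sym Γ Λ)).symm i).arity

variable (Γ Λ) in
/-- The language of the theory that simulates a machine. -/
noncomputable abbrev machineLanguage : FirstOrder.Language.{0, 0} := finLanguage (arities Γ Λ)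

/-- The position of a symbol in the enumeration. -/
noncomputable def Sym.index (s : Sym Γ Λ) : Fin (arities Γ Λ).length :=
  Fin.cast (List.length_ofFn).symm (Fintype.equivFin (Sym Γ Λ) s)

/-- The symbol at a position of the enumeration. -/
noncomputable def Sym.ofIndex (i : Fin (arities Γ Λ).length) : Sym Γ Λ :=
  (Fintype.equivFin (Sym Γ Λ)).symm (Fin.cast List.length_ofFn i)

@[simp]
theorem Sym.ofIndex_index (s : Sym Γ Λ) : Sym.ofIndex s.index = s := by
  exact (Fintype.equivFin (Sym Γ Λ)).symm_apply_apply s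

theorem Sym.arity_ofIndex (i : Fin (arities Γ Λ).length) :
    (Sym.ofIndex i).arity = (arities Γ Λ).get i := by
  exact (List.get_ofFn _ i).symm

/-- A symbol as a function symbol of the language. -/
noncomputable def Sym.toFunction (s : Sym Γ Λ) : (machineLanguage Γ Λ).Functions s.arity :=
  ⟨s.index, by rw [← Sym.arity_ofIndex, Sym.ofIndex_index]⟩

section Terms

variable {α : Type*}

/-- The half-tape `t` with the symbol `a` in front. -/
noncomputable def letterTerm (a : Γ) (t : (machineLanguage Γ Λ).Term α) :
    (machineLanguage Γ Λ).Term α :=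
  .func (Sym.letter a).toFunction ![t]

variable (Γ Λ α) in
/-- The blank half-tape. -/
noncomputable def endTerm : (machineLanguage Γ Λ).Term α :=
  .func Sym.tapeEnd.toFunction ![]

/-- The configuration with state `q` and half-tapes `l` and `r`. -/
noncomputable def stateTerm (q : Λ) (l r : (machineLanguage Γ Λ).Term α) :
    (machineLanguage Γ Λ).Term α :=
  .func (Sym.state q).toFunction ![l, r]

/-- The halted configuration with half-tapes `l` and `r`. -/
noncomputable def haltedTerm (l r : (machineLanguage Γ Λ).Term α) :
    (machineLanguage Γ Λ).Term α :=
  .func Sym.halted.toFunction ![l, r]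

/-- The test of the configuration `c`, with `x` and `y` to be swapped. -/
noncomputable def testTerm (c x y : (machineLanguage Γ Λ).Term α) :
    (machineLanguage Γ Λ).Term α :=
  .func Sym.test.toFunction ![c, x, y]

/-- The half-tape that reads `l` and is blank from there on. -/
noncomputable def tapeTerm (l : List Γ) : (machineLanguage Γ Λ).Term α :=
  l.foldr letterTerm (endTerm Γ Λ α)

@[simp]
theorem tapeTerm_cons (a : Γ) (l : List Γ) :
    (tapeTerm (a :: l) : (machineLanguage Γ Λ).Term α) = letterTerm a (tapeTerm l) :=
  rfl

variable {β : Type*} (σ : α → (machineLanguage Γ Λ).Term β)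

@[simp]
theorem subst_letterTerm (a : Γ) (t : (machineLanguage Γ Λ).Term α) :
    (letterTerm a t).subst σ = letterTerm a (t.subst σ) := by
  simp only [letterTerm, Term.subst]
  congr 1
  funext i
  fin_cases i; rfl

@[simp]
theorem subst_endTerm : (endTerm Γ Λ α).subst σ = endTerm Γ Λ β := by
  simp only [endTerm, Term.subst]
  congr 1
  funext i
  exact i.elim0

@[simp]
theorem subst_stateTerm (q : Λ) (l r : (machineLanguage Γ Λ).Term α) :
    (stateTerm q l r).subst σ = stateTerm q (l.subst σ) (r.subst σ) := by
  simp only [stateTerm, Term.subst]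
  congr 1
  funext i
  fin_cases i <;> rfl

@[simp]
theorem subst_haltedTerm (l r : (machineLanguage Γ Λ).Term α) :
    (haltedTerm l r).subst σ = haltedTerm (l.subst σ) (r.subst σ) := by
  simp only [haltedTerm, Term.subst]
  congr 1
  funext i
  fin_cases i <;> rfl

@[simp]
theorem subst_testTerm (c x y : (machineLanguage Γ Λ).Term α) :
    (testTerm c x y).subst σ = testTerm (c.subst σ) (x.subst σ) (y.subst σ) := by
  simp only [testTerm, Term.subst]
  congr 1
  funext i
  fin_cases i <;> rfl

@[simp]
theorem subst_tapeTerm (l : List Γ) :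
    (tapeTerm l : (machineLanguage Γ Λ).Term α).subst σ = tapeTerm l := by
  induction l with
  | nil => exact subst_endTerm σ
  | cons a l ih => exact (subst_letterTerm σ a _).trans (congrArg _ ih)

variable {n : ℕ} (i : Fin n)

@[simp]
theorem occ_var (j : Fin n) :
    occ i (.var j : (machineLanguage Γ Λ).Term (Fin n)) = if j = i then 1 else 0 :=
  rfl

@[simp]
theorem occ_letterTerm (a : Γ) (t : (machineLanguage Γ Λ).Term (Fin n)) :
    occ i (letterTerm a t) = occ i t := by
  simp only [letterTerm, occ]
  exact Fin.sum_univ_one _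

@[simp]
theorem occ_endTerm : occ i (endTerm Γ Λ (Fin n)) = 0 := by
  simp only [endTerm, occ]
  exact Fin.sum_univ_zero _

@[simp]
theorem occ_stateTerm (q : Λ) (l r : (machineLanguage Γ Λ).Term (Fin n)) :
    occ i (stateTerm q l r) = occ i l + occ i r := by
  simp only [stateTerm, occ]
  exact Fin.sum_univ_two _

@[simp]
theorem occ_haltedTerm (l r : (machineLanguage Γ Λ).Term (Fin n)) :
    occ i (haltedTerm l r) = occ i l + occ i r := by
  simp only [haltedTerm, occ]
  exact Fin.sum_univ_two _

@[simp]
theorem occ_testTerm (c x y : (machineLanguage Γ Λ).Term (Fin n)) :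
    occ i (testTerm c x y) = occ i c + occ i x + occ i y := by
  simp only [testTerm, occ]
  exact Fin.sum_univ_three _

@[simp]
theorem occ_tapeTerm (l : List Γ) :
    occ i (tapeTerm l : (machineLanguage Γ Λ).Term (Fin n)) = 0 := by
  induction l with
  | nil => exact occ_endTerm i
  | cons a l ih => exact (occ_letterTerm i a _).trans ih

end Terms

theorem isLinearRegular_mk_two {s t : (machineLanguage Γ Λ).Term (Fin 2)}
    (hs : occ 0 s = 1 ∧ occ 1 s = 1) (ht : occ 0 t = 1 ∧ occ 1 t = 1) :
    Equation.IsLinearRegular ⟨2, s, t⟩ :=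
  ⟨Fin.forall_fin_two.2 hs, Fin.forall_fin_two.2 ht⟩

variable [Inhabited Γ] [Inhabited Λ]

/-- The indices of those axioms that do not depend on the input. -/
inductive Rule (Γ Λ : Type)
  /-- One step of the machine, from the state `q` with `a` scanned and `b` to the left of it. -/
  | step (q : Λ) (b a : Γ)
  /-- A halted configuration forgets a symbol on the left. -/
  | eraseLeft (a : Γ)
  /-- A halted configuration forgets a symbol on the right. -/
  | eraseRight (a : Γ)
  /-- A blank in front of the blank half-tape changes nothing. -/
  | blank
  deriving Fintype

/-- The configuration after one step from the state `q` with `a` scanned, `b` to the left of it, and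
the variables `0` and `1` for the rest of the two half-tapes. -/
noncomputable def stepTerm (M : TM0.Machine Γ Λ) (q : Λ) (b a : Γ) :
    (machineLanguage Γ Λ).Term (Fin 2) :=
  match M q a with
  | none => haltedTerm (letterTerm b (.var 0)) (letterTerm a (.var 1))
  | some (q', .write c) => stateTerm q' (letterTerm b (.var 0)) (letterTerm c (.var 1))
  | some (q', .move .left) => stateTerm q' (.var 0) (letterTerm b (letterTerm a (.var 1)))
  | some (q', .move .right) => stateTerm q' (letterTerm a (letterTerm b (.var 0))) (.var 1)

/-- The axiom with a given index. None of them changes the order of the variables. -/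
noncomputable def Rule.equation (M : TM0.Machine Γ Λ) :
    Rule Γ Λ → Equation (machineLanguage Γ Λ)
  | step q b a =>
    ⟨2, stateTerm q (letterTerm b (.var 0)) (letterTerm a (.var 1)), stepTerm M q b a⟩
  | eraseLeft a => ⟨2, haltedTerm (letterTerm a (.var 0)) (.var 1), haltedTerm (.var 0) (.var 1)⟩
  | eraseRight a => ⟨2, haltedTerm (.var 0) (letterTerm a (.var 1)), haltedTerm (.var 0) (.var 1)⟩
  | blank => ⟨0, letterTerm default (endTerm Γ Λ _), endTerm Γ Λ _⟩

/-- The initial configuration on the input `l`. -/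
noncomputable def startTerm {α : Type*} (l : List Γ) : (machineLanguage Γ Λ).Term α :=
  stateTerm default (endTerm Γ Λ α) (tapeTerm l)

variable (Λ) in
/-- The axiom `test(start, x, y) = test(halted, y, x)`, the only one that permutes variables. It
yields a symmetry exactly if its two configurations can be identified. -/
noncomputable def swapEquation (l : List Γ) : Equation (machineLanguage Γ Λ) where
  ctx := 2
  lhs := testTerm (startTerm l) (.var 0) (.var 1)
  rhs := testTerm (haltedTerm (endTerm Γ Λ _) (endTerm Γ Λ _)) (.var 1) (.var 0)

/-- The theory that is rigid if and only if `M` does not halt on the input `l`. -/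
noncomputable def machineTheory (M : TM0.Machine Γ Λ) (l : List Γ) : FinTheory where
  arities := arities Γ Λ
  axs := Finset.univ.toList.map (Rule.equation M) ++ [swapEquation Λ l]

/-- The axioms of `machineTheory M l`, as equations over the language `machineLanguage Γ Λ`. -/
def machineAxioms (M : TM0.Machine Γ Λ) (l : List Γ) : Set (Equation (machineLanguage Γ Λ)) :=
  {e | (∃ r, Rule.equation M r = e) ∨ e = swapEquation Λ l}

theorem axiomSet_machineTheory (M : TM0.Machine Γ Λ) (l : List Γ) :
    (machineTheory M l).axiomSet = machineAxioms M l := by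
  have h : ∀ e : Equation (machineLanguage Γ Λ),
      e ∈ Finset.univ.toList.map (Rule.equation M) ++ [swapEquation Λ l] ↔
        (∃ r, Rule.equation M r = e) ∨ e = swapEquation Λ l := by
    simp
  exact Set.ext h

theorem isLinearRegular_of_mem (M : TM0.Machine Γ Λ) (l : List Γ) :
    ∀ e ∈ machineAxioms M l, e.IsLinearRegular := by
  rintro e (⟨r, rfl⟩ | rfl)
  · cases r with
    | step q b a =>
      refine isLinearRegular_mk_two (by simp) ?_
      simp only [stepTerm]
      split <;> simp
    | eraseLeft a => exact isLinearRegular_mk_two (by simp) (by simp)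
    | eraseRight a => exact isLinearRegular_mk_two (by simp) (by simp)
    | blank => exact ⟨fun i => Fin.elim0 i, fun i => Fin.elim0 i⟩
  · exact isLinearRegular_mk_two (by simp [startTerm]) (by simp)

end Theory

/-! ### Derivations that follow a computation -/

section Simulation

open FirstOrder Language Turing

theorem cons_default_mk_nil {Γ : Type*} [Inhabited Γ] :
    ListBlank.cons (default : Γ) (ListBlank.mk []) = ListBlank.mk [] := by
  rw [ListBlank.cons_mk]
  exact (Quotient.sound' (Or.inl ⟨1, rfl⟩)).symm

variable {Γ Λ : Type} [Fintype Γ] [Fintype Λ]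

section Congruence

variable {A : Set (Equation (machineLanguage Γ Λ))} {n : ℕ}
  {s s' t t' : (machineLanguage Γ Λ).Term (Fin n)}

theorem Provable.stateTerm (q : Λ) (h : Provable A s s') (h' : Provable A t t') :
    Provable A (stateTerm q s t) (stateTerm q s' t') := by
  have h₁ := h.update (k := 2) (Sym.state q).toFunction ![s, t] 0
  have h₂ := h'.update (k := 2) (Sym.state q).toFunction ![s', t] 1
  have e₁ : ∀ x, Function.update ![s, t] 0 x = ![x, t] := fun x => by
    funext i; fin_cases i <;> rfl
  have e₂ : ∀ x, Function.update ![s', t] 1 x = ![s', x] := fun x => by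
    funext i; fin_cases i <;> rfl
  rw [e₁, e₁] at h₁
  rw [e₂, e₂] at h₂
  exact h₁.trans h₂

theorem Provable.testTerm (h : Provable A s s') :
    Provable A (testTerm s t t') (testTerm s' t t') := by
  have h₁ := h.update (k := 3) Sym.test.toFunction ![s, t, t'] 0
  have e₁ : ∀ x, Function.update ![s, t, t'] 0 x = ![x, t, t'] := fun x => by
    funext i; fin_cases i <;> rfl
  rw [e₁, e₁] at h₁
  exact h₁

end Congruence

variable [Inhabited Γ] [Inhabited Λ] (M : TM0.Machine Γ Λ) (w : List Γ) {n : ℕ}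

theorem provable_step (q : Λ) (b a : Γ) (s t : (machineLanguage Γ Λ).Term (Fin n)) :
    Provable (machineAxioms M w) (stateTerm q (letterTerm b s) (letterTerm a t))
      ((stepTerm M q b a).subst ![s, t]) := by
  have h := Provable.of_mem (A := machineAxioms M w) (Or.inl ⟨.step q b a, rfl⟩) ![s, t]
  simpa [Rule.equation] using h

theorem provable_blank :
    Provable (machineAxioms M w) (letterTerm default (endTerm Γ Λ (Fin n))) (endTerm Γ Λ _) := by
  have h := Provable.of_mem (A := machineAxioms M w) (n := n) (Or.inl ⟨.blank, rfl⟩) Fin.elim0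
  simpa [Rule.equation] using h

theorem provable_eraseLeft (a : Γ) (s t : (machineLanguage Γ Λ).Term (Fin n)) :
    Provable (machineAxioms M w) (haltedTerm (letterTerm a s) t) (haltedTerm s t) := by
  have h := Provable.of_mem (A := machineAxioms M w) (Or.inl ⟨.eraseLeft a, rfl⟩) ![s, t]
  simpa [Rule.equation] using h

theorem provable_eraseRight (a : Γ) (s t : (machineLanguage Γ Λ).Term (Fin n)) :
    Provable (machineAxioms M w) (haltedTerm s (letterTerm a t)) (haltedTerm s t) := by
  have h := Provable.of_mem (A := machineAxioms M w) (Or.inl ⟨.eraseRight a, rfl⟩) ![s, t]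
  simpa [Rule.equation] using h

theorem provable_swap (s t : (machineLanguage Γ Λ).Term (Fin n)) :
    Provable (machineAxioms M w) (testTerm (startTerm w) s t)
      (testTerm (haltedTerm (endTerm Γ Λ _) (endTerm Γ Λ _)) t s) := by
  have h := Provable.of_mem (A := machineAxioms M w) (Or.inr rfl) ![s, t]
  simpa [swapEquation, startTerm] using h

theorem provable_erase (l r : List Γ) :
    Provable (machineAxioms M w) (haltedTerm (tapeTerm l) (tapeTerm r))
      (haltedTerm (endTerm Γ Λ (Fin n)) (endTerm Γ Λ _)) := by
  induction l with
  | nil =>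
    induction r with
    | nil => exact Relation.EqvGen.refl _
    | cons a r ih => exact (provable_eraseRight M w a _ _).trans ih
  | cons a l ih => exact (provable_eraseLeft M w a _ _).trans ih

/-- A half-tape can be written with a first symbol: if it has none, a blank is put there. -/
theorem exists_tapeTerm_cons (l : List Γ) :
    ∃ (a : Γ) (l' : List Γ), ListBlank.mk l = ListBlank.cons a (ListBlank.mk l') ∧
      Provable (machineAxioms M w) (tapeTerm l)
        (letterTerm a (tapeTerm l') : (machineLanguage Γ Λ).Term (Fin n)) := by
  cases l with
  | nil =>
    refine ⟨default, [], ?_, (provable_blank M w).symm⟩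
    exact cons_default_mk_nil.symm
  | cons a l => exact ⟨a, l, (ListBlank.cons_mk a l).symm, Relation.EqvGen.refl _⟩

theorem provable_of_step (c c' : TM0.Cfg Γ Λ) (h : c' ∈ TM0.step M c) (l r : List Γ)
    (hc : c.Tape = Tape.mk' (ListBlank.mk l) (ListBlank.mk r)) :
    ∃ l' r', c'.Tape = Tape.mk' (ListBlank.mk l') (ListBlank.mk r') ∧
      Provable (machineAxioms M w) (stateTerm c.q (tapeTerm l) (tapeTerm r))
        (stateTerm c'.q (tapeTerm l') (tapeTerm r') : (machineLanguage Γ Λ).Term (Fin n)) := by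
  obtain ⟨q, T⟩ := c
  obtain ⟨b, l, hl, pl⟩ := exists_tapeTerm_cons M w (n := n) l
  obtain ⟨a, r, hr, pr⟩ := exists_tapeTerm_cons M w (n := n) r
  have p := (Provable.stateTerm q pl pr).trans (provable_step M w q b a _ _)
  simp only at hc
  subst hc
  simp only [TM0.step, hl, hr, Tape.mk'_head, ListBlank.head_cons] at h ⊢
  rw [stepTerm] at p
  rcases hM : M q a with _ | ⟨q', (_ | _) | c⟩ <;> rw [hM] at h p <;> cases h
  · refine ⟨l, b :: a :: r, ?_, by simpa using p⟩
    simp [Tape.move_left_mk']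
  · refine ⟨a :: b :: l, r, ?_, by simpa using p⟩
    simp [Tape.move_right_mk']
  · refine ⟨b :: l, c :: r, ?_, by simpa using p⟩
    simp [Tape.write_mk']

theorem provable_of_step_eq_none (c : TM0.Cfg Γ Λ) (h : TM0.step M c = none) (l r : List Γ)
    (hc : c.Tape = Tape.mk' (ListBlank.mk l) (ListBlank.mk r)) :
    Provable (machineAxioms M w) (stateTerm c.q (tapeTerm l) (tapeTerm r))
      (haltedTerm (endTerm Γ Λ (Fin n)) (endTerm Γ Λ _)) := by
  obtain ⟨q, T⟩ := c
  obtain ⟨b, l, hl, pl⟩ := exists_tapeTerm_cons M w (n := n) l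
  obtain ⟨a, r, hr, pr⟩ := exists_tapeTerm_cons M w (n := n) r
  have p := (Provable.stateTerm q pl pr).trans (provable_step M w q b a _ _)
  simp only at hc
  subst hc
  simp only [TM0.step, hl, hr, Tape.mk'_head, ListBlank.head_cons, Option.map_eq_none_iff] at h ⊢
  rw [stepTerm, h] at p
  exact p.trans (by simpa using provable_erase M w (n := n) (b :: l) (a :: r))

theorem provable_of_reaches {c c' : TM0.Cfg Γ Λ} (h : TM0.Reaches M c c')
    (h' : TM0.step M c' = none) (l r : List Γ)
    (hc : c.Tape = Tape.mk' (ListBlank.mk l) (ListBlank.mk r)) :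
    Provable (machineAxioms M w) (stateTerm c.q (tapeTerm l) (tapeTerm r))
      (haltedTerm (endTerm Γ Λ (Fin n)) (endTerm Γ Λ _)) := by
  induction h using Relation.ReflTransGen.head_induction_on generalizing l r with
  | refl => exact provable_of_step_eq_none M w _ h' l r hc
  | head h₁ _ ih =>
    obtain ⟨l', r', hc', p⟩ := provable_of_step M w _ _ h₁ l r hc
    exact p.trans (ih l' r' hc')

theorem not_isRigid_of_halts (h : (TM0.eval M w).Dom) : ¬ IsRigid (machineAxioms M w) := by
  rintro ⟨-, hr⟩
  obtain ⟨c, hc⟩ := Part.dom_iff_mem.1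
    (show (StateTransition.eval (TM0.step M) (TM0.init w)).Dom from h)
  obtain ⟨hc, hc'⟩ := StateTransition.mem_eval.1 hc
  have p : Provable (machineAxioms M w) (startTerm w)
      (haltedTerm (endTerm Γ Λ (Fin 2)) (endTerm Γ Λ _)) :=
    provable_of_reaches M w hc hc' [] w rfl
  -- `test(start, x, y) = test(halted, y, x) = test(start, y, x)`
  have p₂ := (provable_swap M w (.var 0) (.var 1)).trans
    (p.symm.testTerm (t := .var 1) (t' := .var 0))
  have hs := hr 2 (testTerm (startTerm w) (.var 0) (.var 1))
    (Fin.forall_fin_two.2 (by simp [startTerm])) (Equiv.swap 0 1) (by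
      rw [relabel_eq_subst, subst_testTerm]
      simpa [startTerm, Term.subst] using p₂)
  exact absurd (congrArg (fun σ => σ 0) hs) (by decide)

end Simulation

/-! ### A model that records the order of the variables -/

section Model

open FirstOrder Language Turing

variable {Γ Λ : Type}

/-- Elements of the model: what a term stands for as a half-tape, what it stands for as a
configuration, and the order of its variables, which belong to `α`. Every element has all three
components, since the language has only one sort. -/
structure Value (Γ α : Type) [Inhabited Γ] where
  /-- the content of a half-tape -/
  tape : ListBlank Γ
  /-- whether this is a configuration from which the machine halts -/
  halts : Prop
  /-- the variables, in the order in which the term lists them -/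
  vars : List α

variable [Inhabited Γ] [Inhabited Λ] (M : TM0.Machine Γ Λ) {α β : Type}

/-- Renaming of the variables that a value records. -/
def Value.map (f : α → β) (x : Value Γ α) : Value Γ β :=
  ⟨x.tape, x.halts, x.vars.map f⟩

/-- The machine halts from the state `q` and the tape with left half `l` and right half `r`. -/
def HaltsFrom (q : Λ) (l r : ListBlank Γ) : Prop :=
  (StateTransition.eval (TM0.step M) ⟨q, Tape.mk' l r⟩).Dom

open Classical in
/-- The interpretation of the symbols. Components that make no sense for a symbol get a constant
value. The symbol `test` lists its last two arguments in reverse order if its first argument is a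
halting configuration. The last case is that of a wrong number of arguments, which does not occur in
terms. -/
noncomputable def interp : Sym Γ Λ → List (Value Γ α) → Value Γ α
  | .letter a, [x] => ⟨x.tape.cons a, False, x.vars⟩
  | .tapeEnd, [] => ⟨ListBlank.mk [], False, []⟩
  | .state q, [x, y] => ⟨ListBlank.mk [], HaltsFrom M q x.tape y.tape, x.vars ++ y.vars⟩
  | .halted, [x, y] => ⟨ListBlank.mk [], True, x.vars ++ y.vars⟩
  | .test, [c, x, y] => ⟨ListBlank.mk [], False,
      c.vars ++ if c.halts then y.vars ++ x.vars else x.vars ++ y.vars⟩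
  | _, _ => ⟨ListBlank.mk [], False, []⟩

theorem interp_map (f : α → β) (s : Sym Γ Λ) (xs : List (Value Γ α)) :
    interp M s (xs.map (Value.map f)) = (interp M s xs).map f := by
  rcases s with _ | _ | _ | _ | _ <;> rcases xs with _ | ⟨x, _ | ⟨y, _ | ⟨z, _ | _⟩⟩⟩ <;>
    simp [interp, Value.map]
  split <;> simp

theorem mem_interp_vars {s : Sym Γ Λ} {xs : List (Value Γ α)} (h : xs.length = s.arity)
    {x : Value Γ α} (hx : x ∈ xs) {i : α} (hi : i ∈ x.vars) : i ∈ (interp M s xs).vars := by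
  rcases s with _ | _ | _ | _ | _ <;> rcases xs with _ | ⟨x, _ | ⟨y, _ | ⟨z, _ | _⟩⟩⟩ <;>
    simp [Sym.arity] at h hx <;> simp only [interp]
  · subst hx; exact hi
  · rcases hx with rfl | rfl <;> simp [hi]
  · rcases hx with rfl | rfl <;> simp [hi]
  · rcases hx with rfl | rfl | rfl <;> simp only [List.mem_append, hi, true_or] <;>
      split <;> simp [hi]

theorem HaltsFrom.congr {q q' : Λ} {l r l' r' : ListBlank Γ}
    (h : TM0.step M ⟨q, Tape.mk' l r⟩ = some ⟨q', Tape.mk' l' r'⟩) :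
    HaltsFrom M q l r = HaltsFrom M q' l' r' :=
  congrArg Part.Dom (StateTransition.reaches_eval (Relation.ReflTransGen.single h))

theorem HaltsFrom.of_step_eq_none {q : Λ} {l r : ListBlank Γ}
    (h : TM0.step M ⟨q, Tape.mk' l r⟩ = none) : HaltsFrom M q l r :=
  Part.dom_iff_mem.2 ⟨_, StateTransition.mem_eval.2 ⟨Relation.ReflTransGen.refl, h⟩⟩

variable [Fintype Γ] [Fintype Λ]

variable (α) in
/-- The model, as a structure for the language. -/
@[reducible]
noncomputable def valueStructure : (machineLanguage Γ Λ).Structure (Value Γ α) where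
  funMap f xs := interp M (Sym.ofIndex f.1) (List.ofFn xs)
  RelMap r := r.elim

/-- The value of a term under an assignment of values to its variables. -/
noncomputable def value (v : β → Value Γ α) (t : (machineLanguage Γ Λ).Term β) : Value Γ α :=
  @Term.realize _ _ (valueStructure M α) _ v t

section Realize

variable (v : β → Value Γ α)

@[simp]
theorem value_var (i : β) : value M v (.var i) = v i :=
  rfl

theorem value_toFunction (s : Sym Γ Λ) (ts : Fin s.arity → (machineLanguage Γ Λ).Term β) :
    value M v (.func s.toFunction ts) = interp M s (List.ofFn fun i => (value M v (ts i))) :=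
  congrArg (fun s => interp M s (List.ofFn fun i => (value M v (ts i)))) s.ofIndex_index

@[simp]
theorem value_letterTerm (a : Γ) (t : (machineLanguage Γ Λ).Term β) :
    value M v (letterTerm a t) = ⟨(value M v t).tape.cons a, False, (value M v t).vars⟩ :=
  value_toFunction M v (.letter a) _

@[simp]
theorem value_endTerm : value M v (endTerm Γ Λ β) = ⟨ListBlank.mk [], False, []⟩ :=
  value_toFunction M v .tapeEnd _

@[simp]
theorem value_stateTerm (q : Λ) (l r : (machineLanguage Γ Λ).Term β) :
    value M v (stateTerm q l r) =
      ⟨ListBlank.mk [], HaltsFrom M q (value M v l).tape (value M v r).tape,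
        (value M v l).vars ++ (value M v r).vars⟩ :=
  value_toFunction M v (.state q) _

@[simp]
theorem value_haltedTerm (l r : (machineLanguage Γ Λ).Term β) :
    value M v (haltedTerm l r) = ⟨ListBlank.mk [], True, (value M v l).vars ++ (value M v r).vars⟩ :=
  value_toFunction M v .halted _

open Classical in
@[simp]
theorem value_testTerm (c x y : (machineLanguage Γ Λ).Term β) :
    value M v (testTerm c x y) = ⟨ListBlank.mk [], False, (value M v c).vars ++
      if (value M v c).halts then (value M v y).vars ++ (value M v x).vars
      else (value M v x).vars ++ (value M v y).vars⟩ :=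
  value_toFunction M v .test _

theorem value_tapeTerm (l : List Γ) : value M v (tapeTerm l) = ⟨ListBlank.mk l, False, []⟩ := by
  induction l with
  | nil => exact value_endTerm M v
  | cons a l ih => rw [tapeTerm_cons, value_letterTerm, ih, ListBlank.cons_mk]

end Realize

/-- The axioms hold in the model. For `swapEquation` this is where non-halting is used: the initial
configuration does not count as halting but the halted one does, so both sides list `x` before `y`. -/
theorem machineAxioms_value_eq {w : List Γ} (hw : ¬ (TM0.eval M w).Dom) :
    ∀ e ∈ machineAxioms M w, ∀ v : Fin e.ctx → Value Γ α,
      value M v e.lhs =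
        value M v e.rhs := by
  rintro e (⟨r, rfl⟩ | rfl) v
  · cases r with
    | step q b a =>
      change Fin 2 → _ at v
      change value M v (stateTerm q _ _) =
        value M v (stepTerm M q b a)
      have hs : ∀ l r : ListBlank Γ, TM0.step M ⟨q, Tape.mk' (l.cons b) (r.cons a)⟩ =
        (M q a).map fun p => ⟨p.1, match p.2 with
          | .move d => (Tape.mk' (l.cons b) (r.cons a)).move d
          | .write c => (Tape.mk' (l.cons b) (r.cons a)).write c⟩ := by
        intro l r
        rw [TM0.step, Tape.mk'_head, ListBlank.head_cons]
        rfl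
      rw [stepTerm]
      rcases hM : M q a with _ | ⟨q', (_ | _) | c⟩ <;> rw [hM] at hs <;> simp
      · exact HaltsFrom.of_step_eq_none M (hs _ _)
      · refine iff_of_eq (HaltsFrom.congr M ?_)
        simp [hs, Tape.move_left_mk']
      · refine iff_of_eq (HaltsFrom.congr M ?_)
        simp [hs, Tape.move_right_mk']
      · refine iff_of_eq (HaltsFrom.congr M ?_)
        simp [hs, Tape.write_mk']
    | eraseLeft a =>
      change Fin 2 → _ at v
      change value M v (haltedTerm (letterTerm a (.var 0)) (.var 1)) =
        value M v (haltedTerm (.var 0) (.var 1))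
      simp
    | eraseRight a =>
      change Fin 2 → _ at v
      change value M v (haltedTerm (.var 0) (letterTerm a (.var 1))) =
        value M v (haltedTerm (.var 0) (.var 1))
      simp
    | blank =>
      change value M v (letterTerm default (endTerm Γ Λ _)) = value M v (endTerm Γ Λ _)
      rw [value_letterTerm, value_endTerm, cons_default_mk_nil]
  · have hw' : ¬ HaltsFrom M default (ListBlank.mk []) (ListBlank.mk w) := hw
    change Fin 2 → _ at v
    change value M v (testTerm (stateTerm default (endTerm Γ Λ _) (tapeTerm w)) (.var 0) (.var 1)) =
      value M v (testTerm (haltedTerm (endTerm Γ Λ _) (endTerm Γ Λ _)) (.var 1) (.var 0))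
    simp [value_tapeTerm, hw']

theorem mem_value_vars {n : ℕ} (i : Fin n) (t : (machineLanguage Γ Λ).Term (Fin n))
    (h : occ i t ≠ 0) : i ∈ (value M (fun j => ⟨ListBlank.mk [], False, [j]⟩) t).vars := by
  induction t with
  | var j =>
    have hj : j = i := by
      by_contra hj
      exact h (if_neg hj)
    subst hj
    exact List.mem_singleton_self _
  | @func k f ts ih =>
    obtain ⟨j, -, hj⟩ := Finset.exists_ne_zero_of_sum_ne_zero h
    refine mem_interp_vars M ?_ (List.mem_ofFn.2 ⟨j, rfl⟩) (ih j hj)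
    rw [List.length_ofFn, Sym.arity_ofIndex, f.2]

/-- Renaming the variables is a homomorphism of models. -/
theorem value_map (f : α → β) {n : ℕ} (v : Fin n → Value Γ α)
    (t : (machineLanguage Γ Λ).Term (Fin n)) :
    value M (fun j => (v j).map f) t =
      (value M v t).map f := by
  induction t with
  | var j => rfl
  | func g ts ih =>
    refine Eq.trans ?_ (interp_map M f (Sym.ofIndex g.1) _)
    rw [List.map_ofFn]
    exact congrArg (fun xs => interp M (Sym.ofIndex g.1) (List.ofFn xs)) (funext ih)

/-- By soundness, a term and its permuted form list their variables in the same order; hence the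
permutation fixes every variable of the term. -/
theorem isRigid_of_not_halts {w : List Γ} (hw : ¬ (TM0.eval M w).Dom) :
    IsRigid (machineAxioms M w) := by
  refine ⟨isLinearRegularTheory_of_forall (isLinearRegular_of_mem M w), fun n t ht σ h => ?_⟩
  let v : Fin n → Value Γ (Fin n) := fun j => ⟨ListBlank.mk [], False, [j]⟩
  let := valueStructure (Λ := Λ) M (Fin n)
  have h₁ := h.realize_eq (machineAxioms_value_eq M hw) v
  rw [Term.realize_relabel] at h₁
  have h₂ : (value M v t).vars = ((value M v t).map σ).vars :=
    congrArg Value.vars (h₁.trans (value_map M σ v t))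
  refine Equiv.ext fun i => ?_
  have hi := mem_value_vars M i t (by rw [ht i]; exact one_ne_zero)
  exact (List.map_inj_left.1 ((List.map_id _).trans h₂) i hi).symm

end Model

/-! ### Computability of the reduction -/

section Reduction

open FirstOrder Language Turing

variable {Γ Λ : Type} [Fintype Γ] [Fintype Λ]

section Code

variable {n : ℕ}

theorem codeTerm_letterTerm (a : Γ) (t : (machineLanguage Γ Λ).Term (Fin n)) :
    codeTerm (letterTerm a t) = Sum.inr ((Sym.letter a : Sym Γ Λ).index : ℕ) :: codeTerm t := by
  simp only [codeTerm, letterTerm, Term.listEncode, List.map_cons]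
  congr 1
  exact congrArg _ (List.append_nil _)

theorem codeTerm_stateTerm (q : Λ) (l r : (machineLanguage Γ Λ).Term (Fin n)) :
    codeTerm (stateTerm q l r) =
      Sum.inr ((Sym.state q : Sym Γ Λ).index : ℕ) :: (codeTerm l ++ codeTerm r) := by
  simp only [codeTerm, stateTerm, Term.listEncode, List.map_cons, ← List.map_append]
  congr 1
  exact congrArg (fun x => List.map _ (l.listEncode ++ x)) (List.append_nil _)

theorem codeTerm_testTerm (c x y : (machineLanguage Γ Λ).Term (Fin n)) :
    codeTerm (testTerm c x y) =
      Sum.inr ((Sym.test : Sym Γ Λ).index : ℕ) :: (codeTerm c ++ (codeTerm x ++ codeTerm y)) := by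
  simp only [codeTerm, testTerm, Term.listEncode, List.map_cons, ← List.map_append]
  congr 1
  exact congrArg (fun z => List.map _ (c.listEncode ++ (x.listEncode ++ z))) (List.append_nil _)

theorem codeTerm_tapeTerm (l : List Γ) :
    codeTerm (tapeTerm l : (machineLanguage Γ Λ).Term (Fin n)) =
      (l.map fun a => ((Sym.letter a : Sym Γ Λ).index : ℕ)).map Sum.inr ++
        codeTerm (endTerm Γ Λ (Fin n)) := by
  induction l with
  | nil => rfl
  | cons a l ih => rw [tapeTerm_cons, codeTerm_letterTerm, ih]; rfl

end Code

variable [Inhabited Γ] [Inhabited Λ]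

theorem computable_code (M : TM0.Machine Γ Λ) (input : ℕ → List Γ)
    (h : ∀ F : Γ → ℕ, Computable fun n => (input n).map F) :
    Computable fun n => (machineTheory M (input n)).code := by
  have htape : Computable fun n =>
      codeTerm (tapeTerm (input n) : (machineLanguage Γ Λ).Term (Fin 2)) := by
    simp only [codeTerm_tapeTerm]
    exact Computable.list_append.comp
      ((Primrec.list_map Primrec.id (Primrec.sumInr.comp Primrec.snd).to₂).to_comp.comp (h _))
      (Computable.const _)
  have hlhs : Computable fun n => codeTerm (testTerm (startTerm (input n)) (.var 0) (.var 1) :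
      (machineLanguage Γ Λ).Term (Fin 2)) := by
    simp only [codeTerm_testTerm, startTerm, codeTerm_stateTerm]
    exact Computable.list_cons.comp (Computable.const _) (Computable.list_append.comp
      (Computable.list_cons.comp (Computable.const _)
        (Computable.list_append.comp (Computable.const _) htape)) (Computable.const _))
  have hswap := (Computable.const 2).pair (hlhs.pair (Computable.const
    (codeTerm (testTerm (haltedTerm (endTerm Γ Λ _) (endTerm Γ Λ _)) (.var 1) (.var 0) :
      (machineLanguage Γ Λ).Term (Fin 2)))))
  refine ((Computable.const (arities Γ Λ)).pair (Computable.list_append.comp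
    (Computable.const ((Finset.univ.toList.map (Rule.equation M)).map
      fun e => (e.ctx, codeTerm e.lhs, codeTerm e.rhs)))
    (Computable.list_cons.comp hswap (Computable.const [])))).of_eq fun n => ?_
  exact congrArg (Prod.mk _) (List.map_append (l₂ := [swapEquation Λ (input n)])).symm

end Reduction

end RigidTheory

/-- Rigidity is undecidable: no algorithm (partial recursive function), given the code of an
equational theory in a finite language with a finite set of linear-regular axioms, always halts
and answers correctly whether the theory is rigid. -/
theorem theorem1 :
    ¬ ∃ d : RigidTheory.Code →. Bool, Partrec d ∧
      ∀ T : RigidTheory.FinTheory, (∀ e ∈ T.axiomSet, e.IsLinearRegular) →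
        ∃ b ∈ d T.code, (b = true ↔ RigidTheory.IsRigid T.axiomSet) := by
  rintro ⟨d, hd, h⟩
  obtain ⟨Γ, Λ, _, _, _, _, M, input, hinput, hM⟩ := RigidTheory.exists_machine
  have hT : ∀ n, ∃ b ∈ d (RigidTheory.machineTheory M (input n)).code,
      (b = true ↔ ¬ (Turing.TM0.eval M (input n)).Dom) := by
    intro n
    obtain ⟨b, hb, hb'⟩ := h (RigidTheory.machineTheory M (input n)) (by
      rw [RigidTheory.axiomSet_machineTheory]
      exact RigidTheory.isLinearRegular_of_mem M (input n))
    refine ⟨b, hb, hb'.trans ?_⟩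
    rw [RigidTheory.axiomSet_machineTheory]
    exact ⟨fun hr hh => RigidTheory.not_isRigid_of_halts M (input n) hh hr,
      RigidTheory.isRigid_of_not_halts M⟩
  choose b hb hb' using hT
  have hbc : Computable b :=
    (hd.comp (RigidTheory.computable_code M input hinput)).of_eq fun n =>
      Part.eq_some_iff.2 (hb n)
  refine hM (ComputablePred.computable_iff.2 ⟨fun n => !(b n),
    (Primrec.not.to_comp).comp hbc, funext fun n => propext ?_⟩)
  have := hb' n
  cases hbn : b n <;> simp_all
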